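/- **Conventions.** Let $G$ be a residually finite group generated by a finite set $S$, equipped with the left-invariant word metric $d(g,h)=|g^{-1}h|$ of $S$ (the path metric of the Cayley graph). A *filtration* of $G$ is a sequence $(N_i)_{i\ge 0}$ of normal finite index subgroups of $G$ with $\bigcap_i N_i=\{e\}$, such that every $g\neq e$ belongs to only finitely many of the $N_i$ (the last condition is automatic if the sequence is decreasing). Let $X_i$ be the vertex set of the Cayley graph of $G/N_i$ with respect to the image of $S$, with its path metric $d_{X_i}$. The *box space* $\square_{\{N_i\}}G$ is $\bigsqcup_i X_i$ with the metric $$d(x,y)=\begin{cases} d_{X_i}(x,y) & \text{if } x,y\in X_i,\\ \max(\operatorname{diam}X_i,\operatorname{diam}X_j)+1 & \text{if } x\in X_i,\ y\in X_j,\ i\ne j.\end{cases}$$ A metric space $X$ is *coarsely amenable* (has property A) if for all $R,\varepsilon>0$ there are $r>0$ and finitely supported probability measures $(f_x)_{x\in X}$ on $X$ with $\operatorname{supp} f_x\subset B(x,r)$ (closed ball) and $\|f_x-f_y\|_1\le\varepsilon$ whenever $d(x,y)\le R$. For a set $A$ and a finitely supported function $\xi:X\to\ell^\infty(A)$, $z\mapsto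 \xi_z$, with values in the real Banach space $\ell^\infty(A)$, put $\|\xi\|_u=\big\|\sum_{z}|\xi_z|\big\|_\infty$; such a $\xi$ is an *$\ell^\infty(A)$-valued probability measure* if $\xi_z\ge 0$ for all $z$ and $\sum_z\xi_z\equiv 1$. A metric space $X$ is *fibred coarsely amenable* if there is a family $(A_x)_{x\in X}$ of countably infinite sets, with associated Banach spaces $\ell^\infty_x=\ell^\infty(A_x)\cong\ell^\infty(\mathbb N)$, such that for all $R\ge 0$ and $\varepsilon>0$ there are $r\ge 0$ and $\ell^\infty_x$-valued probability measures $\xi^x:X\to\ell^\infty_x$ $(x\in X)$ with $\operatorname{supp}\xi^x\subset B(x,r)$ such that the following holds. For every $L\ge 0$ there are a finite set $K_L\subset X$ and, for every finite $C\subset X\setminus K_L$ of diameter at most $L$, a family of linear isometric isomorphisms $t_C(x):\ell^\infty_x\to\ell^\infty(\mathbb N)$ $(x\in C)$, each induced by a bijection $A_x\to\mathbb N$, such that * for all such $C$ and all $x,y\in C$ with $d(x,y)\le R$: $\|t_C(x)\xi^x-t_C(y)\xi^y\|_u\le\varepsilon$, where $(t_C(x)\xi^x)_z=t_C(x)(\xi^x_z)$;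 * for all such $C_1,C_2$, the isometry $t_{C_1}(x)\circ t_{C_2}(x)^{-1}$ of $\ell^\infty(\mathbb N)$ does not depend on $x\in C_1\cap C_2$. **Theorem.** For every finitely generated residually finite group $G$ and every finite generating set $S$ of $G$, the following are equivalent: 1. $G$ is coarsely amenable; 2. there exists a filtration $(N_i)$ of $G$ such that $\square_{\{N_i\}}G$ is fibred coarsely amenable; 3. for every filtration $(N_i)$ of $G$, $\square_{\{N_i\}}G$ is fibred coarsely amenable. -/

import Mathlib

open scoped ENNReal

noncomputable section

namespace CoarseAmen

/-! ### Cayley graphs as metric spaces -/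

theorem mulCayley_connected {H : Type*} [Group H] (T : Set H) (hT : Subgroup.closure T = ⊤) :
    (SimpleGraph.mulCayley T).Connected := by
  have key : ∀ g : H, ∀ u : H, (SimpleGraph.mulCayley T).Reachable u (u * g) := by
    intro g
    have hg : g ∈ Subgroup.closure T := hT ▸ Subgroup.mem_top g
    induction hg using Subgroup.closure_induction with
    | mem x hx =>
      intro u
      by_cases h : u = u * x
      · exact h ▸ SimpleGraph.Reachable.refl _
      · exact SimpleGraph.Adj.reachable
          ((SimpleGraph.mulCayley_adj' T u (u * x)).2 ⟨h, x, hx, Or.inl rfl⟩)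
    | one => intro u; rw [mul_one]
    | mul x y _ _ hx hy => intro u; rw [← mul_assoc]; exact (hx u).trans (hy (u * x))
    | inv x _ hx => intro u; simpa using (hx (u * x⁻¹)).symm
  have : Nonempty H := ⟨1⟩
  exact ⟨fun u v => by simpa using key (u⁻¹ * v) u⟩

/-- The group `H` (the vertex set of its Cayley graph with respect to the generating set `T`),
equipped with the path metric of the Cayley graph. This is the left-invariant word metric
`d(g, h) = |g⁻¹ h|`. -/
def CayleySpace {H : Type*} [Group H] (T : Set H) (_hT : Subgroup.closure T = ⊤) : Type _ := H

instance {H : Type*} [Group H] (T : Set H) (hT : Subgroup.closure T = ⊤) :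
    MetricSpace (CayleySpace T hT) where
  dist g h := ((SimpleGraph.mulCayley T).dist g h : ℝ)
  dist_self g := by
    exact_mod_cast (SimpleGraph.dist_self : (SimpleGraph.mulCayley T).dist g g = 0)
  dist_comm g h := by
    exact_mod_cast (SimpleGraph.dist_comm :
      (SimpleGraph.mulCayley T).dist g h = (SimpleGraph.mulCayley T).dist h g)
  dist_triangle g h k := by
    exact_mod_cast (mulCayley_connected T hT).dist_triangle (u := g) (v := h) (w := k)
  eq_of_dist_eq_zero {g h} hgh := by
    exact (mulCayley_connected T hT).dist_eq_zero_iff.1 (by exact_mod_cast hgh)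

instance {H : Type*} [Group H] [Finite H] (T : Set H) (hT : Subgroup.closure T = ⊤) :
    Finite (CayleySpace T hT) :=
  inferInstanceAs (Finite H)

/-! ### Coarse disjoint unions -/

/-- The disjoint union of a sequence of metric spaces. -/
def CoarseUnion (E : ℕ → Type*) : Type _ := Σ i, E i

/-- The distance on the coarse disjoint union: the given one inside each piece, and
`max (diam (E i)) (diam (E j)) + 1` between two different pieces `E i` and `E j`. -/
def CoarseUnion.dist {E : ℕ → Type*} [∀ i, MetricSpace (E i)] :
    CoarseUnion E → CoarseUnion E → ℝ
  | ⟨i, x⟩, ⟨j, y⟩ =>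
    if h : i = j then Dist.dist x (cast (congrArg E h.symm) y)
    else max (Metric.diam (Set.univ : Set (E i))) (Metric.diam (Set.univ : Set (E j))) + 1

section

variable {E : ℕ → Type*} [∀ i, MetricSpace (E i)]

theorem CoarseUnion.dist_same (i : ℕ) (x y : E i) :
    CoarseUnion.dist (E := E) ⟨i, x⟩ ⟨i, y⟩ = Dist.dist x y := by
  simp [CoarseUnion.dist]

theorem CoarseUnion.dist_ne {i j : ℕ} (h : i ≠ j) (x : E i) (y : E j) :
    CoarseUnion.dist (E := E) ⟨i, x⟩ ⟨j, y⟩ =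
      max (Metric.diam (Set.univ : Set (E i))) (Metric.diam (Set.univ : Set (E j))) + 1 :=
  dif_neg h

instance [∀ i, Finite (E i)] : MetricSpace (CoarseUnion E) where
  dist := CoarseUnion.dist
  dist_self := by
    rintro ⟨i, x⟩
    exact (CoarseUnion.dist_same i x x).trans (dist_self x)
  dist_comm := by
    rintro ⟨i, x⟩ ⟨j, y⟩
    rcases eq_or_ne i j with rfl | h
    · rw [CoarseUnion.dist_same, CoarseUnion.dist_same, dist_comm]
    · rw [CoarseUnion.dist_ne h, CoarseUnion.dist_ne h.symm, max_comm]
  dist_triangle := by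
    rintro ⟨i, x⟩ ⟨j, y⟩ ⟨k, z⟩
    have hd : ∀ (l : ℕ) (a b : E l), dist a b ≤ Metric.diam (Set.univ : Set (E l)) :=
      fun l a b => Metric.dist_le_diam_of_mem (Set.toFinite _).isBounded
        (Set.mem_univ a) (Set.mem_univ b)
    have h0 : ∀ l : ℕ, 0 ≤ Metric.diam (Set.univ : Set (E l)) := fun l => Metric.diam_nonneg
    rcases eq_or_ne i j with rfl | hij
    · rcases eq_or_ne i k with rfl | hik
      · simp only [CoarseUnion.dist_same]
        exact dist_triangle x y z
      · rw [CoarseUnion.dist_ne hik, CoarseUnion.dist_same, CoarseUnion.dist_ne hik]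
        linarith [dist_nonneg (x := x) (y := y)]
    · rcases eq_or_ne j k with rfl | hjk
      · rw [CoarseUnion.dist_ne hij, CoarseUnion.dist_ne hij, CoarseUnion.dist_same]
        linarith [dist_nonneg (x := y) (y := z)]
      · rw [CoarseUnion.dist_ne hij, CoarseUnion.dist_ne hjk]
        have h1 := le_max_left (Metric.diam (Set.univ : Set (E i)))
          (Metric.diam (Set.univ : Set (E j)))
        have h2 := le_max_right (Metric.diam (Set.univ : Set (E j)))
          (Metric.diam (Set.univ : Set (E k)))
        have h3 := le_max_left (Metric.diam (Set.univ : Set (E j)))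
          (Metric.diam (Set.univ : Set (E k)))
        rcases eq_or_ne i k with rfl | hik
        · rw [CoarseUnion.dist_same]
          linarith [hd i x z, h0 j]
        · rw [CoarseUnion.dist_ne hik]
          have h4 : max (Metric.diam (Set.univ : Set (E i))) (Metric.diam (Set.univ : Set (E k)))
              ≤ max (Metric.diam (Set.univ : Set (E i))) (Metric.diam (Set.univ : Set (E j))) +
                max (Metric.diam (Set.univ : Set (E j))) (Metric.diam (Set.univ : Set (E k))) :=
            max_le (by linarith [h0 j]) (by linarith [h0 j, h0 i])
          linarith
  eq_of_dist_eq_zero := by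
    rintro ⟨i, x⟩ ⟨j, y⟩ h
    change CoarseUnion.dist _ _ = 0 at h
    rcases eq_or_ne i j with rfl | hij
    · rw [CoarseUnion.dist_same] at h
      rw [eq_of_dist_eq_zero h]
    · rw [CoarseUnion.dist_ne hij] at h
      have := le_max_left (Metric.diam (Set.univ : Set (E i)))
        (Metric.diam (Set.univ : Set (E j)))
      linarith [Metric.diam_nonneg (s := (Set.univ : Set (E i)))]

end

/-! ### Filtrations and box spaces -/

/-- A filtration of `G`: a sequence of normal finite index subgroups with trivial intersection
along which every nontrivial element eventually leaves the subgroups, i.e. the quotient maps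
`G → G ⧸ N i` are injective on any given finite set for all large `i`. The last condition follows
from the trivial intersection when the sequence is decreasing. -/
structure Filtration (G : Type*) [Group G] where
  N : ℕ → Subgroup G
  normal : ∀ i, (N i).Normal
  finiteIndex : ∀ i, (N i).FiniteIndex
  iInf_eq_bot : ⨅ i, N i = ⊥
  eventually_notMem : ∀ g : G, g ≠ 1 → ∀ᶠ i in Filter.atTop, g ∉ N i

instance {G : Type*} [Group G] (F : Filtration G) (i : ℕ) : (F.N i).Normal := F.normal i

instance {G : Type*} [Group G] (F : Filtration G) (i : ℕ) : (F.N i).FiniteIndex :=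
  F.finiteIndex i

theorem closure_image_mk {G : Type*} [Group G] (S : Set G) (hS : Subgroup.closure S = ⊤)
    (N : Subgroup G) [N.Normal] : Subgroup.closure (QuotientGroup.mk' N '' S) = ⊤ := by
  rw [← MonoidHom.map_closure, hS, ← MonoidHom.range_eq_map,
    MonoidHom.range_eq_top.2 (QuotientGroup.mk'_surjective N)]

/-- The `i`-th piece of the box space: the Cayley graph of the finite group `G ⧸ N i` with respect
to the image of the generating set `S` of `G`. -/
abbrev BoxPiece {G : Type*} [Group G] (S : Set G) (hS : Subgroup.closure S = ⊤)
    (F : Filtration G) (i : ℕ) : Type _ :=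
  CayleySpace (QuotientGroup.mk' (F.N i) '' S) (closure_image_mk S hS (F.N i))

/-- The box space of `G` associated with a filtration. -/
abbrev BoxSpace {G : Type*} [Group G] (S : Set G) (hS : Subgroup.closure S = ⊤)
    (F : Filtration G) : Type _ :=
  CoarseUnion (BoxPiece S hS F)

/-! ### Coarse amenability -/

/-- Coarse amenability (property A) of a metric space, in the Higson–Roe form: there are finitely
supported probability measures `f x` on `X`, supported in balls of uniformly bounded radius, which
vary slowly in the `ℓ¹` norm. -/
def CoarselyAmenable (X : Type*) [MetricSpace X] : Prop :=
  ∀ R > (0 : ℝ), ∀ ε > (0 : ℝ), ∃ S > (0 : ℝ), ∃ f : X → X →₀ ℝ,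
    (∀ x, (∀ z, 0 ≤ f x z) ∧ ((f x).sum fun _ a => a) = 1) ∧
    (∀ x, ((f x).support : Set X) ⊆ Metric.closedBall x S) ∧
    ∀ x y, dist x y ≤ R → ((f x - f y).sum fun _ a => |a|) ≤ ε

/-! ### Fibred coarse amenability -/

/-- The real Banach space `ℓ^∞(A)` of bounded functions on the set `A`. -/
abbrev EllInfty (A : Type*) : Type _ := lp (fun _ : A => ℝ) ∞

/-- The uniform norm `‖ξ‖_u = ‖∑_z |ξ_z|‖_∞` of a finitely supported function
`ξ : X → ℓ^∞(A)`. -/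
def uniformNorm {X A : Type*} (ξ : X →₀ EllInfty A) : ℝ :=
  ⨆ a : A, ξ.sum fun _ v => |v a|

/-- `ξ : X → ℓ^∞(A)`, finitely supported, is an `ℓ^∞(A)`-valued probability measure:
`ξ_z ≥ 0` for all `z` and `∑_z ξ_z` is the constant function `1`. -/
def IsProbMeasureValued {X A : Type*} (ξ : X →₀ EllInfty A) : Prop :=
  (∀ z a, 0 ≤ ξ z a) ∧ ∀ a, (ξ.sum fun _ v => v a) = 1

/-- The isometry `T` of `ℓ^∞`-spaces arises from a bijection of the base sets. -/
def ArisesFromBijection {A B : Type*} (T : EllInfty A ≃ₗᵢ[ℝ] EllInfty B) : Prop :=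
  ∃ σ : A ≃ B, ∀ (v : EllInfty A) (b : B), T v b = v (σ.symm b)

/-- The image `t ξ` of `ξ : X → ℓ^∞(A)` under an isometry `t`, `(t ξ)_z = t (ξ_z)`. -/
def pushIsometry {X A B : Type*} (t : EllInfty A ≃ₗᵢ[ℝ] EllInfty B) (ξ : X →₀ EllInfty A) :
    X →₀ EllInfty B :=
  ξ.mapRange t (map_zero t)

/-- `C` is a finite subset of `X ∖ K` of diameter at most `L`. -/
def IsSmallOutside {X : Type*} [MetricSpace X] (K : Finset X) (L : ℝ) (C : Finset X) : Prop :=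
  Disjoint C K ∧ Metric.diam (C : Set X) ≤ L

/-- Fibred coarse amenability of a metric space `X`.

The field of Banach spaces has fibres `ℓ^∞_x = ℓ^∞(A x)` for a field of countably infinite sets
`A x`, so that each fibre is a copy of `ℓ^∞(ℕ)`. The trivialisation over a finite set `C` is given
by its restrictions `t C x : ℓ^∞_x → ℓ^∞(ℕ)` to the fibres over the points `x ∈ C`; the values of
`t C x` for other pairs `C, x` carry no condition and play no role. -/
def FibredCoarselyAmenable (X : Type*) [MetricSpace X] : Prop :=
  ∃ A : X → Type, (∀ x, Nonempty (A x ≃ ℕ)) ∧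
    ∀ R ≥ (0 : ℝ), ∀ ε > (0 : ℝ), ∃ S ≥ (0 : ℝ), ∃ ξ : ∀ x : X, X →₀ EllInfty (A x),
      (∀ x, ((ξ x).support : Set X) ⊆ Metric.closedBall x S) ∧
      (∀ x, IsProbMeasureValued (ξ x)) ∧
      ∀ L ≥ (0 : ℝ), ∃ K : Finset X,
        ∃ t : Finset X → ∀ x : X, EllInfty (A x) ≃ₗᵢ[ℝ] EllInfty ℕ,
          (∀ C, IsSmallOutside K L C → ∀ x ∈ C, ArisesFromBijection (t C x)) ∧
          (∀ C, IsSmallOutside K L C → ∀ x ∈ C, ∀ y ∈ C, dist x y ≤ R →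
            uniformNorm (pushIsometry (t C x) (ξ x) - pushIsometry (t C y) (ξ y)) ≤ ε) ∧
          (∀ C₁ C₂, IsSmallOutside K L C₁ → IsSmallOutside K L C₂ →
            ∀ x, x ∈ C₁ → x ∈ C₂ → ∀ y, y ∈ C₁ → y ∈ C₂ →
              (t C₂ x).symm.trans (t C₁ x) = (t C₂ y).symm.trans (t C₁ y))

end CoarseAmen

end

open scoped ENNReal

noncomputable section

namespace CoarseAmen

/-! Far out, the pieces `G ⧸ N i` look like `G` on any prescribed scale, because the quotient map is
injective on a given ball for all large `i`. If `G` is infinite, the diameters of the pieces tend to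
infinity, so a set of bounded diameter missing finitely many points lies in a single far piece
(`exists_finset_isSmallOutside`). If `G` is finite, both properties hold by taking a constant Dirac
mass.

From `G` to box spaces: the fibre over `p` is indexed by the lifts of `p` to `G`, and the measure at
the lift `g` is the pushforward of `f g`. Over a small set `C` with a chosen base point, the fibres
are identified by right multiplication by short elements. Far out these elements are unique
(`IsShift.inv_mul_mem`). Hence equal labels over neighbouring points belong to neighbouring lifts,
and a change of trivialisation is right multiplication by one element, the same at every point.

From a box space to `G`: trivialise over the image of a ball of radius `k` in a far piece and
evaluate at one label. The resulting measures lift to `G`, with supports bounded independently of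
`k` (`FibredCoarselyAmenable.exists_local_measures`). An ultrafilter limit in `k` gives measures on
all of `G`. -/

open scoped Pointwise

/-! ### Word balls -/

section WordBall

variable {H : Type*} [Group H]

/-- The ball of radius `n` around `1` for the word metric of `T`. -/
def wordBall (T : Set H) (n : ℕ) : Set H := (insert 1 (T ∪ T⁻¹)) ^ n

theorem one_mem_wordBall (T : Set H) (n : ℕ) : (1 : H) ∈ wordBall T n :=
  Set.one_mem_pow (Set.mem_insert _ _)

theorem wordBall_mono (T : Set H) {m n : ℕ} (h : m ≤ n) : wordBall T m ⊆ wordBall T n :=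
  Set.pow_subset_pow_right (Set.mem_insert _ _) h

theorem mul_mem_wordBall {T : Set H} {m n : ℕ} {g h : H} (hg : g ∈ wordBall T m)
    (hh : h ∈ wordBall T n) : g * h ∈ wordBall T (m + n) := by
  rw [wordBall, pow_add]
  exact Set.mul_mem_mul hg hh

theorem inv_mem_wordBall {T : Set H} {n : ℕ} {g : H} (hg : g ∈ wordBall T n) :
    g⁻¹ ∈ wordBall T n := by
  have h : (insert 1 (T ∪ T⁻¹) : Set H)⁻¹ = insert 1 (T ∪ T⁻¹) := by
    ext x
    simp [or_comm]
  rw [wordBall, ← h, inv_pow, Set.inv_mem_inv]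
  exact hg

theorem wordBall_finite {T : Set H} (hT : T.Finite) (n : ℕ) : (wordBall T n).Finite := by
  have h : (insert 1 (T ∪ T⁻¹) : Set H).Finite := (hT.union hT.inv).insert 1
  induction n with
  | zero => simp [wordBall]
  | succ n ih =>
    rw [wordBall, pow_succ]
    exact Set.Finite.mul ih h

theorem image_wordBall {H' : Type*} [Group H'] (π : H →* H') (T : Set H) (n : ℕ) :
    π '' wordBall T n = wordBall (π '' T) n := by
  rw [wordBall, wordBall, Set.image_pow, Set.image_insert_eq, Set.image_union, map_one,
    Set.image_inv]

/-- Each edge of a walk contributes one letter, and each letter moves a vertex by at most one edge.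
Distances thus become products of generators, which pass to quotients. -/
theorem mulCayley_dist_le_iff (T : Set H) (hT : Subgroup.closure T = ⊤) (n : ℕ) (g h : H) :
    (SimpleGraph.mulCayley T).dist g h ≤ n ↔ g⁻¹ * h ∈ wordBall T n := by
  have step : ∀ u v : H, (SimpleGraph.mulCayley T).Adj u v → u⁻¹ * v ∈ wordBall T 1 := by
    intro u v huv
    obtain ⟨-, s, hs, rfl | rfl⟩ := (SimpleGraph.mulCayley_adj' T u v).1 huv <;>
      simp [wordBall, hs]
  constructor
  · intro hle
    obtain ⟨p, hp⟩ := (mulCayley_connected T hT).exists_walk_length_eq_dist g h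
    refine wordBall_mono T (hp.trans_le hle) ?_
    clear hp hle
    induction p with
    | nil => simpa using one_mem_wordBall T 0
    | cons huv p ih =>
      rw [SimpleGraph.Walk.length_cons, add_comm]
      simpa [mul_assoc] using mul_mem_wordBall (step _ _ huv) ih
  · induction n generalizing h with
    | zero =>
      intro hgh
      rw [wordBall, pow_zero, Set.mem_one, inv_mul_eq_one] at hgh
      simp [hgh]
    | succ n ih =>
      intro hgh
      rw [wordBall, pow_succ] at hgh
      obtain ⟨w, hw, s, hs, hws⟩ := Set.mem_mul.1 hgh
      have h1 := ih (g * w) (by simpa [wordBall] using hw)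
      have h2 : h = g * w * s := by rw [mul_assoc, hws, mul_inv_cancel_left]
      refine ((mulCayley_connected T hT).dist_triangle (v := g * w)).trans
        (Nat.add_le_add h1 ?_)
      by_cases hne : g * w = h
      · simp [hne]
      · refine (SimpleGraph.dist_eq_one_iff_adj.2 ?_).le
        refine (SimpleGraph.mulCayley_adj' T _ _).2 ⟨hne, ?_⟩
        rcases hs with rfl | hs | hs
        · exact absurd (by simp [h2]) hne
        · exact ⟨s, hs, Or.inl h2.symm⟩
        · exact ⟨s⁻¹, hs, Or.inr (by simp [h2])⟩

theorem CayleySpace.dist_le_natCast_iff {T : Set H} {hT : Subgroup.closure T = ⊤} (n : ℕ)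
    (g h : CayleySpace T hT) :
    dist g h ≤ n ↔ (show H from g)⁻¹ * (show H from h) ∈ wordBall T n := by
  rw [← mulCayley_dist_le_iff T hT]
  exact Nat.cast_le (α := ℝ)

theorem CayleySpace.dist_le_iff {T : Set H} {hT : Subgroup.closure T = ⊤} {R : ℝ} (hR : 0 ≤ R)
    (g h : CayleySpace T hT) :
    dist g h ≤ R ↔ (show H from g)⁻¹ * (show H from h) ∈ wordBall T ⌊R⌋₊ := by
  rw [← mulCayley_dist_le_iff T hT, Nat.le_floor_iff hR]
  exact Iff.rfl

theorem exists_mem_wordBall {T : Set H} (hT : Subgroup.closure T = ⊤) (g : H) :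
    ∃ n, g ∈ wordBall T n :=
  ⟨_, by simpa using (mulCayley_dist_le_iff T hT _ 1 g).1 le_rfl⟩

theorem iUnion_wordBall {T : Set H} (hT : Subgroup.closure T = ⊤) :
    ⋃ n, wordBall T n = Set.univ :=
  Set.eq_univ_of_forall fun g => Set.mem_iUnion.2 (exists_mem_wordBall hT g)

theorem countable_of_finite_generating {T : Set H} (hfin : T.Finite)
    (hT : Subgroup.closure T = ⊤) : Countable H := by
  rw [← Set.countable_univ_iff, ← iUnion_wordBall hT]
  exact Set.countable_iUnion fun n => (wordBall_finite hfin n).countable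

theorem exists_forall_mem_wordBall [Finite H] {T : Set H} (hT : Subgroup.closure T = ⊤) :
    ∃ n, ∀ g, g ∈ wordBall T n := by
  choose n hn using exists_mem_wordBall hT
  obtain ⟨m, hm⟩ := (Set.finite_range n).bddAbove
  exact ⟨m, fun g => wordBall_mono T (hm (Set.mem_range_self g)) (hn g)⟩

end WordBall

/-! ### Filtrations -/

section Filtration

variable {G : Type*} [Group G]

theorem Filtration.eventually_eq_one (F : Filtration G) {E : Set G} (hE : E.Finite) :
    ∀ᶠ i in Filter.atTop, ∀ g ∈ E, g ∈ F.N i → g = 1 := by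
  rw [Filter.eventually_all_finite hE]
  intro g _
  by_cases hg : g = 1
  · simp [hg]
  · exact (F.eventually_notMem g hg).mono fun i hi h => absurd h hi

theorem exists_filtration [Group.ResiduallyFinite G] {S : Set G} (hfin : S.Finite)
    (hS : Subgroup.closure S = ⊤) : Nonempty (Filtration G) := by
  -- Supplies the value of `M` at `1`, which still occurs in the intersections below and does no
  -- harm there.
  have : Nonempty (FiniteIndexNormalSubgroup G) := ⟨.ofSubgroup ⊤⟩
  choose! M hM using fun (g : G) (hg : g ≠ 1) =>
    Group.exists_finiteIndexNormalSubgroup_notMem g hg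
  let N : ℕ → Subgroup G := fun n =>
    ⨅ g : (wordBall_finite hfin n).toFinset, (M g).toSubgroup
  have hN : ∀ g ≠ 1, ∀ n, g ∈ wordBall S n → g ∉ N n := fun g hg n hgn h =>
    hM g hg (Subgroup.mem_iInf.1 h ⟨g, by simpa using hgn⟩)
  refine ⟨⟨N, fun n => ?_, fun n => ?_, ?_, fun g hg => ?_⟩⟩
  · exact Subgroup.normal_iInf_normal fun g => (M g).isNormal'
  · exact Subgroup.finiteIndex_iInf fun g => (M g).isFiniteIndex'
  · refine (Subgroup.eq_bot_iff_forall _).2 fun g hg => by_contra fun hne => ?_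
    obtain ⟨n, hn⟩ := exists_mem_wordBall hS g
    exact hN g hne n hn (Subgroup.mem_iInf.1 hg n)
  · obtain ⟨n, hn⟩ := exists_mem_wordBall hS g
    exact Filter.eventually_atTop.2 ⟨n, fun m hm => hN g hg m (wordBall_mono S hm hn)⟩

end Filtration

/-! ### Distances in box spaces -/

section BoxSpace

variable {G : Type*} [Group G] {S : Set G} {hS : Subgroup.closure S = ⊤} {F : Filtration G}

/-- The image in the `i`-th piece of the box space of an element of `G`. -/
def toBox (S : Set G) (hS : Subgroup.closure S = ⊤) (F : Filtration G) (i : ℕ) (g : G) :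
    BoxSpace S hS F :=
  ⟨i, (QuotientGroup.mk' (F.N i) g : G ⧸ F.N i)⟩

theorem exists_toBox_eq (p : BoxSpace S hS F) : ∃ g, toBox S hS F p.1 g = p := by
  obtain ⟨i, x⟩ := p
  obtain ⟨g, hg⟩ := QuotientGroup.mk'_surjective (F.N i) x
  exact ⟨g, Sigma.ext rfl (heq_of_eq hg)⟩

theorem toBox_eq_iff {i : ℕ} {g h : G} :
    toBox S hS F i g = toBox S hS F i h ↔ g⁻¹ * h ∈ F.N i := by
  rw [← QuotientGroup.eq]
  exact ⟨fun h => eq_of_heq (Sigma.mk.inj h).2, fun h => Sigma.ext rfl (heq_of_eq h)⟩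

/-- Balls around the identity in the quotient are images of balls in `G`, so a short path in a piece
lifts to a short right multiplier. -/
theorem dist_toBox_le_iff {R : ℝ} (hR : 0 ≤ R) (i : ℕ) (g h : G) :
    dist (toBox S hS F i g) (toBox S hS F i h) ≤ R ↔
      ∃ s ∈ wordBall S ⌊R⌋₊, toBox S hS F i (g * s) = toBox S hS F i h := by
  have h1 : dist (toBox S hS F i g) (toBox S hS F i h) =
      dist (α := BoxPiece S hS F i) (QuotientGroup.mk' (F.N i) g) (QuotientGroup.mk' (F.N i) h) :=
    CoarseUnion.dist_same (E := BoxPiece S hS F) i _ _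
  rw [h1]
  refine (CayleySpace.dist_le_iff hR _ _).trans ?_
  rw [← image_wordBall]
  refine exists_congr fun s => and_congr_right fun _ => ?_
  rw [toBox_eq_iff]
  change (QuotientGroup.mk s : G ⧸ F.N i) = QuotientGroup.mk (g⁻¹ * h) ↔ _
  rw [QuotientGroup.eq, mul_inv_rev, mul_assoc]

theorem dist_toBox_le {R : ℝ} (hR : 0 ≤ R) (i : ℕ) {g h : G} (hgh : g⁻¹ * h ∈ wordBall S ⌊R⌋₊) :
    dist (toBox S hS F i g) (toBox S hS F i h) ≤ R :=
  (dist_toBox_le_iff hR i g h).2 ⟨_, hgh, by rw [mul_inv_cancel_left]⟩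

theorem boxSpace_bounded [Finite G] :
    ∃ D : ℝ, ∀ p q : BoxSpace S hS F, dist p q ≤ D := by
  obtain ⟨n, hn⟩ := exists_forall_mem_wordBall hS
  have hd : ∀ i (x y : BoxPiece S hS F i), dist x y ≤ n := by
    intro i x y
    rw [CayleySpace.dist_le_natCast_iff, ← image_wordBall]
    obtain ⟨g, hg⟩ := QuotientGroup.mk'_surjective (F.N i)
      ((show G ⧸ F.N i from x)⁻¹ * (show G ⧸ F.N i from y))
    exact ⟨g, hn g, hg⟩
  refine ⟨n + 1, ?_⟩
  rintro ⟨i, x⟩ ⟨j, y⟩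
  change CoarseUnion.dist _ _ ≤ _
  rcases eq_or_ne i j with rfl | hij
  · rw [CoarseUnion.dist_same]
    linarith [hd i x y]
  · rw [CoarseUnion.dist_ne hij]
    have := fun i => Metric.diam_le_of_forall_dist_le (s := (Set.univ : Set (BoxPiece S hS F i)))
      (Nat.cast_nonneg n) fun x _ y _ => hd i x y
    linarith [max_le (this i) (this j)]

/-- An element `g` outside the ball of radius `⌈L⌉₊` keeps its image outside the image of that ball
for large `i`. So piece `i` has diameter above `L`, and its distance to every other piece, near or
far, exceeds this diameter. -/
theorem eventually_lt_dist_of_ne [Infinite G] (hfin : S.Finite) (L : ℝ) :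
    ∀ᶠ i in Filter.atTop, ∀ p q : BoxSpace S hS F, p.1 = i → q.1 ≠ i → L < dist p q := by
  obtain ⟨g, hg⟩ := (wordBall_finite hfin ⌈L⌉₊).infinite_compl.nonempty
  filter_upwards [F.eventually_eq_one (E := (fun b => g⁻¹ * b) '' wordBall S ⌈L⌉₊)
    ((wordBall_finite hfin _).image _)] with i hi
  rintro ⟨j, x⟩ ⟨k, y⟩ rfl hne
  change L < CoarseUnion.dist _ _
  rw [CoarseUnion.dist_ne (Ne.symm hne)]
  have h1 : ¬ dist (α := BoxPiece S hS F j) (1 : G ⧸ F.N j) (QuotientGroup.mk' (F.N j) g)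
      ≤ (⌈L⌉₊ : ℝ) := by
    refine mt (CayleySpace.dist_le_natCast_iff _ _ _).1 ?_
    rw [← image_wordBall]
    rintro ⟨b, hb, hbg⟩
    change (QuotientGroup.mk b : G ⧸ F.N j) = 1⁻¹ * QuotientGroup.mk g at hbg
    rw [inv_one, one_mul, eq_comm, QuotientGroup.eq] at hbg
    have := hi _ ⟨b, hb, rfl⟩ hbg
    rw [inv_mul_eq_one] at this
    exact hg (this ▸ hb)
  have h2 := Metric.dist_le_diam_of_mem (Set.toFinite _).isBounded
    (Set.mem_univ (show BoxPiece S hS F j from (1 : G ⧸ F.N j)))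
    (Set.mem_univ (show BoxPiece S hS F j from QuotientGroup.mk' (F.N j) g))
  have h3 := le_max_left (Metric.diam (Set.univ : Set (BoxPiece S hS F j)))
    (Metric.diam (Set.univ : Set (BoxPiece S hS F k)))
  have h4 := Nat.le_ceil L
  push Not at h1
  linarith

theorem exists_finset_pieces_lt (S : Set G) (hS : Subgroup.closure S = ⊤) (F : Filtration G)
    (n : ℕ) : ∃ K : Finset (BoxSpace S hS F), ∀ p, p.1 < n → p ∈ K := by
  have : (⋃ i ∈ Set.Iio n, Set.range (fun x : BoxPiece S hS F i =>
      (⟨i, x⟩ : BoxSpace S hS F))).Finite :=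
    (Set.finite_Iio n).biUnion fun i _ => Set.finite_range _
  refine ⟨this.toFinset, ?_⟩
  rintro ⟨i, x⟩ hi
  exact this.mem_toFinset.2 (Set.mem_biUnion (Set.mem_Iio.2 hi) ⟨x, rfl⟩)

end BoxSpace

/-! ### The `ℓ¹` norm of finitely supported functions -/

section L1

variable {X Y : Type*}

theorem sum_abs_add_le (f g : X →₀ ℝ) :
    ((f + g).sum fun _ a => |a|) ≤ (f.sum fun _ a => |a|) + g.sum fun _ a => |a| := by
  classical
  rw [Finsupp.sum_of_support_subset (f + g) Finsupp.support_add _ (by simp),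
    Finsupp.sum_of_support_subset f (Finset.subset_union_left (s₂ := g.support)) _ (by simp),
    Finsupp.sum_of_support_subset g (Finset.subset_union_right (s₁ := f.support)) _ (by simp),
    ← Finset.sum_add_distrib]
  exact Finset.sum_le_sum fun z _ => abs_add_le _ _

theorem sum_abs_mapDomain_le (v : X → Y) (f : X →₀ ℝ) :
    ((f.mapDomain v).sum fun _ a => |a|) ≤ f.sum fun _ a => |a| := by
  refine (Finset.le_sum_of_subadditive (fun f : Y →₀ ℝ => f.sum fun _ a => |a|) (by simp)
    sum_abs_add_le _ _).trans (Finset.sum_le_sum fun z _ => ?_)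
  simp [Finsupp.sum_single_index]

theorem apply_le_one_of_sum_eq_one {f : X →₀ ℝ} (h0 : ∀ z, 0 ≤ f z)
    (h1 : (f.sum fun _ a => a) = 1) (z : X) : f z ≤ 1 := by
  classical
  by_cases hz : z ∈ f.support
  · rw [← h1]
    exact Finset.single_le_sum (f := f) (fun w _ => h0 w) hz
  · rw [Finsupp.notMem_support_iff.1 hz]
    exact zero_le_one

end L1

/-! ### Isometries induced by bijections -/

section Isometry

variable {A B : Type*}

theorem memℓp_infty_comp (σ : B → A) (v : EllInfty A) :
    Memℓp (fun b => v (σ b) : B → ℝ) ∞ := by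
  obtain ⟨c, hc⟩ := memℓp_infty_iff.1 (lp.memℓp v)
  refine memℓp_infty ⟨c, ?_⟩
  rintro _ ⟨b, rfl⟩
  exact hc ⟨σ b, rfl⟩

/-- The isometry of `ℓ^∞`-spaces induced by a bijection of the base sets. -/
def isometryOfEquiv (σ : A ≃ B) : EllInfty A ≃ₗᵢ[ℝ] EllInfty B where
  toFun v := ⟨fun b => v (σ.symm b), memℓp_infty_comp σ.symm v⟩
  invFun v := ⟨fun a => v (σ a), memℓp_infty_comp σ v⟩
  map_add' _ _ := rfl
  map_smul' _ _ := rfl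
  left_inv v := by
    ext a
    change v (σ.symm (σ a)) = v a
    rw [σ.symm_apply_apply]
  right_inv v := by
    ext b
    change v (σ (σ.symm b)) = v b
    rw [σ.apply_symm_apply]
  norm_map' v := by
    rw [lp.norm_eq_ciSup, lp.norm_eq_ciSup]
    exact σ.symm.iSup_comp (g := fun a => ‖v a‖)

@[simp]
theorem isometryOfEquiv_apply (σ : A ≃ B) (v : EllInfty A) (b : B) :
    isometryOfEquiv σ v b = v (σ.symm b) := rfl

@[simp]
theorem isometryOfEquiv_symm_apply (σ : A ≃ B) (v : EllInfty B) (a : A) :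
    (isometryOfEquiv σ).symm v a = v (σ a) := rfl

theorem sum_abs_le_uniformNorm {X : Type*} (ξ : X →₀ EllInfty A) (a : A) :
    (ξ.sum fun _ v => |v a|) ≤ uniformNorm ξ := by
  -- A real supremum needs an upper bound: the sum of the sup norms serves for all labels.
  refine le_ciSup (f := fun a => ξ.sum fun _ v => |v a|) ⟨ξ.sum fun _ v => ‖v‖, ?_⟩ a
  rintro _ ⟨a, rfl⟩
  exact Finset.sum_le_sum fun z _ => lp.norm_apply_le_norm ENNReal.top_ne_zero (ξ z) a

end Isometry

/-! ### A criterion for fibred coarse amenability -/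

/-- Fibred coarse amenability in terms of real valued probability measures indexed by the elements
of the sets `A x`. -/
theorem FibredCoarselyAmenable.of_equiv {X : Type*} [MetricSpace X] (A : X → Type*)
    (hA : ∀ x, Nonempty (A x ≃ ℕ))
    (h : ∀ R ≥ (0 : ℝ), ∀ ε > (0 : ℝ), ∃ r ≥ (0 : ℝ), ∃ ψ : ∀ x, A x → X →₀ ℝ,
      (∀ x, ∃ E : Finset X, (E : Set X) ⊆ Metric.closedBall x r ∧ ∀ a, (ψ x a).support ⊆ E) ∧
      (∀ x a, (∀ z, 0 ≤ ψ x a z) ∧ ((ψ x a).sum fun _ c => c) = 1) ∧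
      ∀ L ≥ (0 : ℝ), ∃ K : Finset X, ∃ σ : Finset X → ∀ x, A x ≃ ℕ,
        (∀ C, IsSmallOutside K L C → ∀ x ∈ C, ∀ y ∈ C, dist x y ≤ R → ∀ n,
          ((ψ x ((σ C x).symm n) - ψ y ((σ C y).symm n)).sum fun _ c => |c|) ≤ ε) ∧
        (∀ C₁ C₂, IsSmallOutside K L C₁ → IsSmallOutside K L C₂ →
          ∀ x, x ∈ C₁ → x ∈ C₂ → ∀ y, y ∈ C₁ → y ∈ C₂ →
            ∀ n, σ C₁ x ((σ C₂ x).symm n) = σ C₁ y ((σ C₂ y).symm n))) :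
    FibredCoarselyAmenable X := by
  -- The definition asks for sets in `Type`, so the fibres are transported to `ℕ`.
  let e := fun x => (hA x).some
  refine ⟨fun _ => ℕ, fun _ => ⟨Equiv.refl ℕ⟩, fun R hR ε hε => ?_⟩
  obtain ⟨r, hr, ψ, hsupp, hprob, hL⟩ := h R hR ε hε
  choose E hE hψE using hsupp
  have hbdd : ∀ x z, Memℓp (fun n => ψ x ((e x).symm n) z : ℕ → ℝ) ∞ := by
    intro x z
    refine memℓp_infty ⟨1, ?_⟩
    rintro _ ⟨n, rfl⟩
    obtain ⟨h0, h1⟩ := hprob x ((e x).symm n)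
    simpa [abs_of_nonneg (h0 z)] using apply_le_one_of_sum_eq_one h0 h1 z
  have hzero : ∀ x a z, z ∉ E x → ψ x a z = 0 := fun x a z hz =>
    Finsupp.notMem_support_iff.1 fun h => hz (hψE x a h)
  let ξ : ∀ x : X, X →₀ EllInfty ℕ := fun x =>
    Finsupp.onFinset (E x) (fun z => ⟨fun n => ψ x ((e x).symm n) z, hbdd x z⟩) fun z hz => by
      by_contra hzE
      exact hz (lp.ext (funext fun n => hzero x _ z hzE))
  have hξ : ∀ x z n, ξ x z n = ψ x ((e x).symm n) z := fun _ _ _ => rfl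
  have hξE : ∀ x, (ξ x).support ⊆ E x := fun x => Finsupp.support_onFinset_subset
  refine ⟨r, hr, ξ, fun x => (Finset.coe_subset.2 (hξE x)).trans (hE x), fun x => ⟨?_, ?_⟩, ?_⟩
  · intro z n
    rw [hξ]
    exact (hprob x _).1 z
  · intro n
    rw [← (hprob x ((e x).symm n)).2, Finsupp.sum_of_support_subset _ (hξE x) _ (by simp),
      Finsupp.sum_of_support_subset _ (hψE x _) _ (by simp)]
    exact Finset.sum_congr rfl fun z _ => hξ x z n
  · intro L hL0
    obtain ⟨K, σ, hclose, hcompat⟩ := hL L hL0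
    refine ⟨K, fun C x => isometryOfEquiv ((e x).symm.trans (σ C x)),
      fun C _ x _ => ⟨_, fun v b => rfl⟩, fun C hC x hx y hy hxy => ?_, ?_⟩
    · classical
      refine ciSup_le fun n => le_trans (le_of_eq ?_) (hclose C hC x hx y hy hxy n)
      have key : ∀ x, (pushIsometry (isometryOfEquiv ((e x).symm.trans (σ C x))) (ξ x)).support
          ⊆ E x := fun x => Finsupp.support_mapRange.trans (hξE x)
      rw [Finsupp.sum_of_support_subset _
          (Finsupp.support_sub.trans (Finset.union_subset_union (key x) (key y))) _ (by simp),
        Finsupp.sum_of_support_subset _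
          (Finsupp.support_sub.trans (Finset.union_subset_union (hψE x _) (hψE y _))) _ (by simp)]
      refine Finset.sum_congr rfl fun z _ => ?_
      simp [pushIsometry, hξ]
    · intro C₁ C₂ h₁ h₂ x hx₁ hx₂ y hy₁ hy₂
      ext v n
      -- The two sets trade places because isometries act by composition with the inverse bijection.
      have h3 := (hcompat C₂ C₁ h₂ h₁ x hx₂ hx₁ y hy₂ hy₁ n)
      simp [h3]

/-- Bounded metric spaces are fibred coarsely amenable. -/
theorem FibredCoarselyAmenable.of_bounded {X : Type*} [MetricSpace X] [Nonempty X] {D : ℝ}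
    (hD : ∀ x y : X, dist x y ≤ D) : FibredCoarselyAmenable X := by
  obtain ⟨x₀⟩ := ‹Nonempty X›
  refine .of_equiv (fun _ => ℕ) (fun _ => ⟨Equiv.refl ℕ⟩) fun R _ ε hε =>
    ⟨D, dist_nonneg.trans (hD x₀ x₀), fun _ _ => Finsupp.single x₀ 1, fun x => ⟨{x₀}, ?_, ?_⟩,
      fun x a => ⟨fun z => ?_, by simp⟩, fun L _ => ⟨∅, fun _ _ => Equiv.refl ℕ, ?_, ?_⟩⟩
  · simp [hD]
  · simp [Finsupp.support_single]
  · classical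
    rw [Finsupp.single_apply]
    split <;> norm_num
  · simp [hε.le]
  · simp

/-! ### From coarse amenability of the group to box spaces -/

section ToBoxSpace

variable {G : Type*} [Group G] {S : Set G} {hS : Subgroup.closure S = ⊤} {F : Filtration G}

theorem coarselyAmenable_cayleySpace_iff :
    CoarselyAmenable (CayleySpace S hS) ↔ ∀ n : ℕ, ∀ ε > (0 : ℝ), ∃ m : ℕ, ∃ f : G → G →₀ ℝ,
      (∀ g, (∀ h, 0 ≤ f g h) ∧ ((f g).sum fun _ a => a) = 1) ∧
      (∀ g, ∀ h ∈ (f g).support, g⁻¹ * h ∈ wordBall S m) ∧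
      ∀ g h, g⁻¹ * h ∈ wordBall S n → ((f g - f h).sum fun _ a => |a|) ≤ ε := by
  constructor
  · intro H n ε hε
    -- Radii in `CoarselyAmenable` must be positive, hence `n + 1` here and `m + 1` below.
    obtain ⟨r, hr, f, hprob, hsupp, hclose⟩ := H (n + 1) (by positivity) ε hε
    refine ⟨⌊r⌋₊, f, hprob, fun g h hh => ?_, fun g h hgh => hclose g h ?_⟩
    · exact (CayleySpace.dist_le_iff hr.le _ _).1 (Metric.mem_closedBall'.1 (hsupp g hh))
    · exact ((CayleySpace.dist_le_natCast_iff n _ _).2 hgh).trans (by linarith)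
  · intro H R hR ε hε
    obtain ⟨m, f, hprob, hsupp, hclose⟩ := H ⌊R⌋₊ ε hε
    refine ⟨m + 1, by positivity, f, hprob, fun g h hh => ?_, fun g h hgh => hclose g h ?_⟩
    · refine Metric.mem_closedBall'.2
        (((CayleySpace.dist_le_natCast_iff m _ _).2 (hsupp g h hh)).trans (by linarith))
    · exact (CayleySpace.dist_le_iff hR.le _ _).1 hgh

/-- The set of lifts to `G` of a point of the box space. -/
abbrev BoxFiber (p : BoxSpace S hS F) : Type _ := {g : G // toBox S hS F p.1 g = p}

/-- The factor `ℕ` makes the index set infinite with no need to know that the fibre is. -/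
theorem nonempty_boxFiber_prod_equiv (hfin : S.Finite) (p : BoxSpace S hS F) :
    Nonempty (BoxFiber p × ℕ ≃ ℕ) := by
  have := countable_of_finite_generating hfin hS
  obtain ⟨g, hg⟩ := exists_toBox_eq p
  have : Nonempty (BoxFiber p) := ⟨⟨g, hg⟩⟩
  exact nonempty_equiv_of_countable

/-- Right multiplication by `s` maps the lifts of `p` onto the lifts of `q`. -/
def IsShift (s : G) (p q : BoxSpace S hS F) : Prop :=
  ∀ g, toBox S hS F p.1 g = p ↔ toBox S hS F q.1 (g * s) = q

theorem IsShift.trans {s t : G} {p q u : BoxSpace S hS F} (hs : IsShift s p q)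
    (ht : IsShift t q u) : IsShift (s * t) p u := fun g => by
  rw [hs g, ht, mul_assoc]

theorem IsShift.symm {s : G} {p q : BoxSpace S hS F} (hs : IsShift s p q) :
    IsShift s⁻¹ q p := fun g => by
  rw [hs, inv_mul_cancel_right]

/-- This yields uniqueness of short shifts wherever the subgroup contains no short nontrivial
element. -/
theorem IsShift.inv_mul_mem {s t : G} {p q : BoxSpace S hS F} (hs : IsShift s p q)
    (ht : IsShift t p q) : s⁻¹ * t ∈ F.N q.1 := by
  obtain ⟨g, hg⟩ := exists_toBox_eq p
  have := toBox_eq_iff.1 (((hs g).1 hg).trans ((ht g).1 hg).symm)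
  simpa [mul_assoc] using this

/-- A short multiplier exists for one lift; normality of the subgroup makes it work for all lifts at
once. -/
theorem exists_isShift {R : ℝ} (hR : 0 ≤ R) {p q : BoxSpace S hS F} (hpq : p.1 = q.1)
    (hd : dist p q ≤ R) : ∃ s ∈ wordBall S ⌊R⌋₊, IsShift s p q := by
  obtain ⟨g, hg⟩ := exists_toBox_eq p
  obtain ⟨h, hh⟩ := exists_toBox_eq q
  rw [← hpq] at hh
  rw [← hg, ← hh] at hd
  obtain ⟨s, hs, hgs⟩ := (dist_toBox_le_iff hR _ _ _).1 hd
  refine ⟨s, hs, fun k => ?_⟩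
  rw [← hpq]
  nth_rw 2 [← hg]
  rw [← hh, ← hgs, toBox_eq_iff, toBox_eq_iff,
    show (k * s)⁻¹ * (g * s) = s⁻¹ * (k⁻¹ * g) * s⁻¹⁻¹ by group]
  exact ⟨fun h => (F.normal _).conj_mem _ h _, fun h => by
    simpa [mul_assoc] using (F.normal _).conj_mem _ h s⟩

/-- The bijection between fibres given by a shift. -/
def IsShift.equiv {s : G} {p q : BoxSpace S hS F} (hs : IsShift s p q) :
    BoxFiber p ≃ BoxFiber q :=
  (Equiv.mulRight s).subtypeEquiv hs

theorem IsShift.coe_equiv_symm {s : G} {p q : BoxSpace S hS F} (hs : IsShift s p q)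
    (a : BoxFiber q) : (hs.equiv.symm a : G) = a * s⁻¹ := rfl

/-- A finite set of small diameter which avoids sufficiently many pieces of the box space of an
infinite group lies in a single piece, and in this piece shifts by short elements are unique. -/
theorem exists_finset_isSmallOutside [Infinite G] (hfin : S.Finite) (n : ℕ) (L : ℝ) :
    ∃ K : Finset (BoxSpace S hS F), ∀ C, IsSmallOutside K L C → ∀ p ∈ C,
      (∀ g ∈ wordBall S n, g ∈ F.N p.1 → g = 1) ∧ ∀ q ∈ C, p.1 = q.1 ∧ dist p q ≤ L := by
  obtain ⟨i₀, hi₀⟩ := Filter.eventually_atTop.1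
    ((F.eventually_eq_one (wordBall_finite hfin n)).and
      (eventually_lt_dist_of_ne (hS := hS) (F := F) hfin L))
  obtain ⟨K, hK⟩ := exists_finset_pieces_lt S hS F i₀
  refine ⟨K, fun C hC p hp => ?_⟩
  have hp₀ : i₀ ≤ p.1 := not_lt.1 fun h => Finset.disjoint_left.1 hC.1 hp (hK p h)
  refine ⟨(hi₀ _ hp₀).1, fun q hq => ?_⟩
  have hd : dist p q ≤ L :=
    (Metric.dist_le_diam_of_mem C.finite_toSet.isBounded hp hq).trans hC.2
  exact ⟨by_contra fun hne => ((hi₀ _ hp₀).2 p q rfl (Ne.symm hne)).not_ge hd, hd⟩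

theorem CoarselyAmenable.fibred_boxSpace_of_infinite [Infinite G] (hfin : S.Finite)
    (H : CoarselyAmenable (CayleySpace S hS)) (F : Filtration G) :
    FibredCoarselyAmenable (BoxSpace S hS F) := by
  classical
  refine .of_equiv (fun p => BoxFiber p × ℕ) (nonempty_boxFiber_prod_equiv hfin)
    fun R hR ε hε => ?_
  obtain ⟨r, f, hprob, hsupp, hclose⟩ := coarselyAmenable_cayleySpace_iff.1 H ⌊R⌋₊ ε hε
  refine ⟨r, r.cast_nonneg, fun p a => (f a.1).mapDomain (toBox S hS F p.1), fun p => ?_,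
    fun p a => ⟨fun z => ?_, ?_⟩, fun L hL => ?_⟩
  -- One finite set must contain the supports for all lifts of `p`: the points within `r` of `p` in
  -- the pieces up to `p.1`.
  · obtain ⟨K, hK⟩ := exists_finset_pieces_lt S hS F (p.1 + 1)
    refine ⟨K.filter fun q => dist q p ≤ r, fun q hq => (Finset.mem_filter.1 hq).2, ?_⟩
    rintro ⟨⟨g, hg⟩, k⟩ q hq
    obtain ⟨h, hh, rfl⟩ := Finset.mem_image.1 (Finsupp.mapDomain_support hq)
    refine Finset.mem_filter.2 ⟨hK _ (Nat.lt_succ_self _), ?_⟩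
    nth_rw 2 [← hg]
    rw [dist_comm]
    refine dist_toBox_le r.cast_nonneg _ ?_
    rw [Nat.floor_natCast]
    exact hsupp g h hh
  · beta_reduce
    rw [Finsupp.mapDomain, Finsupp.sum_apply]
    refine Finset.sum_nonneg fun h _ => ?_
    beta_reduce
    rw [Finsupp.single_apply]
    split
    · exact (hprob _).1 h
    · exact le_rfl
  · rw [Finsupp.sum_mapDomain_index (fun _ => rfl) fun _ _ _ => rfl]
    exact (hprob _).2
  have hM : 0 ≤ max L R := hR.trans (le_max_right _ _)
  set n := ⌊max L R⌋₊
  -- Comparing two changes of trivialisation involves a product of four shifts, each in the ball of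
  -- radius `n`; comparing two points involves three.
  obtain ⟨K, hK⟩ := exists_finset_isSmallOutside (hS := hS) (F := F) hfin (n + n + (n + n)) L
  obtain ⟨b, hb⟩ : ∃ b : Finset (BoxSpace S hS F) → BoxSpace S hS F,
      ∀ C : Finset (BoxSpace S hS F), C.Nonempty → b C ∈ C :=
    ⟨fun C => if h : C.Nonempty then h.choose else toBox S hS F 0 1, fun C h => by
      simpa only [dif_pos h] using h.choose_spec⟩
  let e := fun p : BoxSpace S hS F => (nonempty_boxFiber_prod_equiv hfin p).some
  have hσ : ∀ C (p : BoxSpace S hS F), ∃ σ : BoxFiber p × ℕ ≃ ℕ, IsSmallOutside K L C → p ∈ C →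
      ∃ s ∈ wordBall S n, ∃ hs : IsShift s p (b C),
        σ = (hs.equiv.prodCongr (Equiv.refl ℕ)).trans (e (b C)) := by
    intro C p
    by_cases h : IsSmallOutside K L C ∧ p ∈ C
    · obtain ⟨hpb, hd⟩ := (hK C h.1 p h.2).2 (b C) (hb C ⟨p, h.2⟩)
      obtain ⟨s, hs, hs'⟩ := exists_isShift hM hpb (hd.trans (le_max_left _ _))
      exact ⟨_, fun _ _ => ⟨s, hs, hs', rfl⟩⟩
    · exact ⟨e p, fun h₁ h₂ => absurd ⟨h₁, h₂⟩ h⟩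
  choose σ hσ using hσ
  refine ⟨K, σ, fun C hC p hp q hq hpq k => ?_, fun C₁ C₂ h₁ h₂ p hp₁ hp₂ q hq₁ hq₂ k => ?_⟩
  · obtain ⟨s, hs, hs', hσp⟩ := hσ C p hC hp
    obtain ⟨t, ht, ht', hσq⟩ := hσ C q hC hq
    have hpq₁ := ((hK C hC p hp).2 q hq).1
    obtain ⟨u, hu, hu'⟩ := exists_isShift hR hpq₁ hpq
    have hun := wordBall_mono S (Nat.floor_mono (le_max_right L R)) hu
    -- Both `u` and `s * t⁻¹`, the passage through the base point, shift `p` to `q`; both are short,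
    -- so they agree.
    have h1 : u⁻¹ * (s * t⁻¹) = 1 := by
      refine (hK C hC q hq).1 _ ?_ (hu'.inv_mul_mem (hs'.trans ht'.symm))
      exact wordBall_mono S (by omega) (mul_mem_wordBall (inv_mem_wordBall hun)
        (mul_mem_wordBall hs (inv_mem_wordBall ht)))
    rw [inv_mul_eq_one] at h1
    simp only [hσp, hσq, hpq₁]
    -- As `p` and `q` lie in one piece, both measures are pushed forward along the same map, which
    -- does not increase the `ℓ¹` norm.
    rw [← Finsupp.mapDomain.addMonoidHom_apply, ← Finsupp.mapDomain.addMonoidHom_apply, ← map_sub]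
    refine (sum_abs_mapDomain_le _ _).trans (hclose _ _ ?_)
    simpa [IsShift.coe_equiv_symm, mul_assoc, ← h1] using hu
  · obtain ⟨s₁, hs₁, hs₁', hσp₁⟩ := hσ C₁ p h₁ hp₁
    obtain ⟨s₂, hs₂, hs₂', hσp₂⟩ := hσ C₂ p h₂ hp₂
    obtain ⟨t₁, ht₁, ht₁', hσq₁⟩ := hσ C₁ q h₁ hq₁
    obtain ⟨t₂, ht₂, ht₂', hσq₂⟩ := hσ C₂ q h₂ hq₂
    -- Passing from `b C₂` to `b C₁` through `p` or through `q` gives two short shifts between the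
    -- same points.
    have h1 : (s₂⁻¹ * s₁)⁻¹ * (t₂⁻¹ * t₁) = 1 := by
      refine (hK C₁ h₁ (b C₁) (hb _ ⟨p, hp₁⟩)).1 _ ?_
        ((hs₂'.symm.trans hs₁').inv_mul_mem (ht₂'.symm.trans ht₁'))
      exact mul_mem_wordBall (inv_mem_wordBall (mul_mem_wordBall (inv_mem_wordBall hs₂) hs₁))
        (mul_mem_wordBall (inv_mem_wordBall ht₂) ht₁)
    rw [inv_mul_eq_one] at h1
    rw [hσp₁, hσp₂, hσq₁, hσq₂]
    refine congrArg (e (b C₁)) (Prod.ext (Subtype.ext ?_) rfl)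
    change (_ * s₂⁻¹) * s₁ = (_ * t₂⁻¹) * t₁
    rw [mul_assoc, h1, mul_assoc]

theorem CoarselyAmenable.fibred_boxSpace (hfin : S.Finite)
    (H : CoarselyAmenable (CayleySpace S hS)) (F : Filtration G) :
    FibredCoarselyAmenable (BoxSpace S hS F) := by
  rcases finite_or_infinite G with _ | _
  · obtain ⟨D, hD⟩ := boxSpace_bounded (hS := hS) (F := F)
    have : Nonempty (BoxSpace S hS F) := ⟨toBox S hS F 0 1⟩
    exact .of_bounded hD
  · exact H.fibred_boxSpace_of_infinite hfin F

end ToBoxSpace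

/-! ### From box spaces to coarse amenability of the group -/

section FromBoxSpace

open Filter Topology

variable {G : Type*} [Group G] {S : Set G} {hS : Subgroup.closure S = ⊤} {F : Filtration G}

/-- Evaluating the trivialisation over a finite set `C` at a point of `ℕ` turns a field of vector
valued probability measures into honest probability measures which vary slowly over `C`. -/
theorem exists_probMeasures_of_trivialisation {X : Type*} [MetricSpace X] {A : X → Type*}
    (hA : ∀ x, Nonempty (A x ≃ ℕ)) {ξ : ∀ x : X, X →₀ EllInfty (A x)}
    (hprob : ∀ x, IsProbMeasureValued (ξ x)) {C : Finset X}
    {t : ∀ x : X, EllInfty (A x) ≃ₗᵢ[ℝ] EllInfty ℕ} (ht : ∀ x ∈ C, ArisesFromBijection (t x))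
    {R ε : ℝ} (hclose : ∀ x ∈ C, ∀ y ∈ C, dist x y ≤ R →
      uniformNorm (pushIsometry (t x) (ξ x) - pushIsometry (t y) (ξ y)) ≤ ε) :
    ∃ Q : X → X →₀ ℝ, (∀ x, (Q x).support ⊆ (ξ x).support) ∧
      (∀ x, (∀ z, 0 ≤ Q x z) ∧ ((Q x).sum fun _ a => a) = 1) ∧
      ∀ x ∈ C, ∀ y ∈ C, dist x y ≤ R → ((Q x - Q y).sum fun _ a => |a|) ≤ ε := by
  classical
  have hτ : ∀ x, ∃ a : A x, x ∈ C → ∀ v, t x v 0 = v a := by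
    intro x
    by_cases hx : x ∈ C
    · obtain ⟨σ, hσ⟩ := ht x hx
      exact ⟨σ.symm 0, fun _ v => hσ v 0⟩
    · exact ⟨(hA x).some.symm 0, fun h => absurd h hx⟩
  choose τ hτ using hτ
  have hsupp : ∀ x, ((ξ x).mapRange (fun v : EllInfty (A x) => v (τ x)) rfl).support ⊆
      (ξ x).support := fun x => Finsupp.support_mapRange
  refine ⟨fun x => (ξ x).mapRange (fun v => v (τ x)) rfl, hsupp, fun x => ⟨?_, ?_⟩, ?_⟩
  · intro z
    exact (hprob x).1 z (τ x)
  · exact (Finsupp.sum_mapRange_index (by simp)).trans ((hprob x).2 (τ x))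
  · intro x hx y hy hxy
    refine le_trans (le_of_eq ?_) ((sum_abs_le_uniformNorm _ 0).trans (hclose x hx y hy hxy))
    have key : ∀ x, (pushIsometry (t x) (ξ x)).support ⊆ (ξ x).support :=
      fun x => Finsupp.support_mapRange
    rw [Finsupp.sum_of_support_subset _
        (Finsupp.support_sub.trans (Finset.union_subset_union (key x) (key y))) _ (by simp),
      Finsupp.sum_of_support_subset _
        (Finsupp.support_sub.trans (Finset.union_subset_union (hsupp x) (hsupp y))) _ (by simp)]
    refine Finset.sum_congr rfl fun z _ => ?_
    simp [pushIsometry, hτ x hx, hτ y hy]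
    rfl

/-- The ball of radius `m` around `g` for the word metric. -/
def ballFinset (hfin : S.Finite) (m : ℕ) (g : G) : Finset G :=
  (wordBall_finite hfin m).toFinset.map (mulLeftEmbedding g)

theorem mem_ballFinset (hfin : S.Finite) {m : ℕ} {g h : G} :
    h ∈ ballFinset hfin m g ↔ g⁻¹ * h ∈ wordBall S m := by
  simp only [ballFinset, Finset.mem_map, Set.Finite.mem_toFinset, mulLeftEmbedding_apply]
  exact ⟨by rintro ⟨s, hs, rfl⟩; rwa [inv_mul_cancel_left], fun h' => ⟨_, h', by group⟩⟩

/-- Large balls of `G` embed into the box space, and so inherit slowly varying probability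
measures, with a uniform bound on the supports. -/
theorem FibredCoarselyAmenable.exists_local_measures [Infinite G] (hfin : S.Finite)
    (H : FibredCoarselyAmenable (BoxSpace S hS F)) (n : ℕ) {ε : ℝ} (hε : 0 < ε) :
    ∃ m : ℕ, ∀ k : ℕ, ∃ φ : G → G → ℝ,
      (∀ g h, φ g h ∈ Set.Icc (0 : ℝ) 1) ∧ (∀ g, ∀ h ∉ ballFinset hfin m g, φ g h = 0) ∧
      (∀ g ∈ wordBall S k, ∑ h ∈ ballFinset hfin m g, φ g h = 1) ∧
      ∀ g ∈ wordBall S k, ∀ g' ∈ wordBall S k, g⁻¹ * g' ∈ wordBall S n →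
        ∀ E : Finset G, (E : Set G) ⊆ wordBall S (k + m) → ∑ h ∈ E, |φ g h - φ g' h| ≤ ε := by
  classical
  obtain ⟨A, hA, H⟩ := H
  obtain ⟨r, hr, ξ, hsupp, hprob, H⟩ := H n n.cast_nonneg ε hε
  refine ⟨⌊r⌋₊, fun k => ?_⟩
  set m := ⌊r⌋₊
  obtain ⟨K, t, ht, hclose, -⟩ := H (k + k : ℕ) (Nat.cast_nonneg _)
  have hK : ∀ᶠ i in atTop, ∀ p ∈ K, p.1 ≠ i :=
    (eventually_all_finset K).2 fun p _ => (eventually_ne_atTop p.1).mono fun _ h => h.symm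
  -- The piece avoids `K`, is farther than `r` from all others, and receives the ball of radius `k +
  -- m` injectively; quotients of two elements of that ball account for the doubled radius.
  obtain ⟨i, hKi, hinj, hpiece⟩ := (hK.and
    ((F.eventually_eq_one (wordBall_finite hfin (k + m + (k + m)))).and
      (eventually_lt_dist_of_ne (hS := hS) (F := F) hfin r))).exists
  have hinj' : Set.InjOn (toBox S hS F i) (wordBall S (k + m)) := fun g hg h hh hgh =>
    inv_mul_eq_one.1 (hinj _ (mul_mem_wordBall (inv_mem_wordBall hg) hh) (toBox_eq_iff.1 hgh))
  set C := (wordBall_finite hfin k).toFinset.image (toBox S hS F i)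
  have hmemC : ∀ g ∈ wordBall S k, toBox S hS F i g ∈ C := fun g hg =>
    Finset.mem_image_of_mem _ ((wordBall_finite hfin k).mem_toFinset.2 hg)
  have hC : IsSmallOutside K (k + k : ℕ) C := by
    refine ⟨Finset.disjoint_left.2 fun p hp hpK => ?_,
      Metric.diam_le_of_forall_dist_le (Nat.cast_nonneg _) fun p hp q hq => ?_⟩
    · obtain ⟨g, -, rfl⟩ := Finset.mem_image.1 hp
      exact hKi _ hpK rfl
    · obtain ⟨g, hg, rfl⟩ := Finset.mem_image.1 (Finset.mem_coe.1 hp)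
      obtain ⟨h, hh, rfl⟩ := Finset.mem_image.1 (Finset.mem_coe.1 hq)
      rw [Set.Finite.mem_toFinset] at hg hh
      refine dist_toBox_le (Nat.cast_nonneg _) _ ?_
      rw [Nat.floor_natCast]
      exact mul_mem_wordBall (inv_mem_wordBall hg) hh
  obtain ⟨Q, hQsupp, hQprob, hQclose⟩ :=
    exists_probMeasures_of_trivialisation hA hprob (ht C hC) (hclose C hC)
  have hlift : ∀ g q, q ∈ (Q (toBox S hS F i g)).support →
      ∃ s ∈ wordBall S m, toBox S hS F i (g * s) = q := by
    intro g q hq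
    have hd : dist (toBox S hS F i g) q ≤ r :=
      Metric.mem_closedBall'.1 (hsupp _ (hQsupp _ hq))
    have hqi : q.1 = i := by_contra fun hne => (hpiece _ q rfl hne).not_ge hd
    obtain ⟨h, hh⟩ := exists_toBox_eq q
    rw [hqi] at hh
    rw [← hh] at hd ⊢
    exact (dist_toBox_le_iff hr _ _ _).1 hd
  -- The cutoff makes the support bound hold for every `g`; by `hφ` it changes nothing when `g` is
  -- in the ball of radius `k` and `h` in that of radius `k + m`.
  let φ : G → G → ℝ := fun g h =>
    if h ∈ ballFinset hfin m g then Q (toBox S hS F i g) (toBox S hS F i h) else 0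
  have hφ : ∀ g ∈ wordBall S k, ∀ h ∈ wordBall S (k + m),
      φ g h = Q (toBox S hS F i g) (toBox S hS F i h) := by
    intro g hg h hh
    by_cases hgh : h ∈ ballFinset hfin m g
    · exact if_pos hgh
    · refine (if_neg hgh).trans (Finsupp.notMem_support_iff.1 fun hne => hgh ?_).symm
      obtain ⟨s, hs, hgs⟩ := hlift g _ hne
      rw [mem_ballFinset, ← hinj' (mul_mem_wordBall hg hs) hh hgs, inv_mul_cancel_left]
      exact hs
  have hball : ∀ g ∈ wordBall S k, ∀ h ∈ ballFinset hfin m g, h ∈ wordBall S (k + m) := by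
    intro g hg h hh
    rw [← mul_inv_cancel_left g h]
    exact mul_mem_wordBall hg ((mem_ballFinset hfin).1 hh)
  refine ⟨φ, fun g h => ?_, fun g h hgh => if_neg hgh, fun g hg => ?_,
    fun g hg g' hg' hgg' E hE => ?_⟩
  · by_cases hgh : h ∈ ballFinset hfin m g
    · rw [show φ g h = _ from if_pos hgh]
      exact ⟨(hQprob _).1 _, apply_le_one_of_sum_eq_one (hQprob _).1 (hQprob _).2 _⟩
    · rw [show φ g h = _ from if_neg hgh]
      exact ⟨le_rfl, zero_le_one⟩
  · rw [← (hQprob (toBox S hS F i g)).2,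
      Finset.sum_congr rfl fun h hh => hφ g hg h (hball g hg h hh),
      ← Finset.sum_image (f := Q (toBox S hS F i g)) fun a ha b hb =>
        hinj' (hball g hg a ha) (hball g hg b hb)]
    refine (Finsupp.sum_of_support_subset _ (fun q hq => ?_) (fun _ a => a)
      (by simp)).symm
    obtain ⟨s, hs, rfl⟩ := hlift g q hq
    refine Finset.mem_image_of_mem _ ((mem_ballFinset hfin).2 ?_)
    rwa [inv_mul_cancel_left]
  · rw [Finset.sum_congr rfl fun h hh => by rw [hφ g hg h (hE hh), hφ g' hg' h (hE hh)]]
    have hd : dist (toBox S hS F i g) (toBox S hS F i g') ≤ n :=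
      dist_toBox_le n.cast_nonneg _ (by rwa [Nat.floor_natCast])
    refine le_trans ?_ (hQclose _ (hmemC g hg) _ (hmemC g' hg') hd)
    rw [Finsupp.sum_of_support_subset _ (Finset.subset_union_left (s₂ := E.image (toBox S hS F i)))
        _ (by simp),
      ← Finset.sum_image (f := fun z => |Q (toBox S hS F i g) z - Q (toBox S hS F i g') z|)
        fun a ha b hb => hinj' (hE ha) (hE hb)]
    exact Finset.sum_le_sum_of_subset_of_nonneg Finset.subset_union_right
      fun _ _ _ => abs_nonneg _

/-- The values lie in the compact interval from `0` to `1`, so they converge along an ultrafilter.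
Masses and `ℓ¹` distances are sums over finite balls independent of `k`, hence pass to the limit. -/
theorem FibredCoarselyAmenable.coarselyAmenable_of_infinite [Infinite G] (hfin : S.Finite)
    (H : FibredCoarselyAmenable (BoxSpace S hS F)) :
    CoarselyAmenable (CayleySpace S hS) := by
  classical
  refine coarselyAmenable_cayleySpace_iff.2 fun n ε hε => ?_
  obtain ⟨m, hm⟩ := H.exists_local_measures hfin n hε
  choose φ hIcc hzero hsum hclose using hm
  have hlim : ∀ g h, ∃ c ∈ Set.Icc (0 : ℝ) 1,
      Tendsto (fun k => φ k g h) (hyperfilter ℕ) (𝓝 c) := fun g h =>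
    isCompact_Icc.ultrafilter_le_nhds ((hyperfilter ℕ).map fun k => φ k g h)
      (tendsto_principal.2 (Eventually.of_forall fun k => hIcc k g h))
  choose c hc hlim using hlim
  -- The hyperfilter refines `atTop`, so each fixed `g` ends up in the region where `φ k` is
  -- controlled.
  have hev : ∀ g, ∀ᶠ k in hyperfilter ℕ, g ∈ wordBall S k := by
    intro g
    obtain ⟨k, hk⟩ := exists_mem_wordBall hS g
    exact Nat.hyperfilter_le_atTop
      (eventually_atTop.2 ⟨k, fun l hl => wordBall_mono S hl hk⟩)
  have hc0 : ∀ g, ∀ h ∉ ballFinset hfin m g, c g h = 0 := fun g h hgh =>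
    tendsto_nhds_unique (hlim g h)
      (tendsto_const_nhds.congr fun k => (hzero k g h hgh).symm)
  let f : G → G →₀ ℝ := fun g => Finsupp.onFinset (ballFinset hfin m g) (c g) fun h hne =>
    by_contra fun hgh => hne (hc0 g h hgh)
  have hf : ∀ g, (f g).support ⊆ ballFinset hfin m g := fun g => Finsupp.support_onFinset_subset
  refine ⟨m, f, fun g => ⟨fun h => (hc g h).1, ?_⟩, fun g h hh =>
    (mem_ballFinset hfin).1 (hf g hh), fun g g' hgg' => ?_⟩
  · rw [Finsupp.sum_of_support_subset _ (hf g) _ (by simp)]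
    refine tendsto_nhds_unique (tendsto_finsetSum _ fun h _ => hlim g h)
      (tendsto_const_nhds.congr' ?_)
    filter_upwards [hev g] with k hk
    exact (hsum k g hk).symm
  · rw [Finsupp.sum_of_support_subset _
      (Finsupp.support_sub.trans (Finset.union_subset_union (hf g) (hf g'))) _ (by simp)]
    refine le_of_tendsto (tendsto_finsetSum _ fun h _ => ((hlim g h).sub (hlim g' h)).abs) ?_
    filter_upwards [hev g, hev g'] with k hk hk'
    refine hclose k g hk g' hk' hgg' _ fun h hh => ?_
    rcases Finset.mem_union.1 hh with hh | hh
    · rw [← mul_inv_cancel_left g h]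
      exact mul_mem_wordBall hk ((mem_ballFinset hfin).1 hh)
    · rw [← mul_inv_cancel_left g' h]
      exact mul_mem_wordBall hk' ((mem_ballFinset hfin).1 hh)

theorem coarselyAmenable_cayleySpace_of_finite [Finite G] :
    CoarselyAmenable (CayleySpace S hS) := by
  classical
  refine coarselyAmenable_cayleySpace_iff.2 fun n ε hε => ?_
  obtain ⟨m, hm⟩ := exists_forall_mem_wordBall hS
  refine ⟨m, fun _ => Finsupp.single 1 1, fun g => ⟨fun h => ?_, by simp⟩, fun g h _ => hm _,
    fun g h _ => by simp [hε.le]⟩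
  rw [Finsupp.single_apply]
  split <;> norm_num

theorem FibredCoarselyAmenable.coarselyAmenable (hfin : S.Finite)
    (H : FibredCoarselyAmenable (BoxSpace S hS F)) :
    CoarselyAmenable (CayleySpace S hS) := by
  rcases finite_or_infinite G with _ | _
  · exact coarselyAmenable_cayleySpace_of_finite
  · exact H.coarselyAmenable_of_infinite hfin

end FromBoxSpace

end CoarseAmen

end

theorem theorem2p4 {G : Type*} [Group G] [Group.ResiduallyFinite G] (S : Finset G)
    (hS : Subgroup.closure (S : Set G) = ⊤) :
    List.TFAE
      [CoarseAmen.CoarselyAmenable (CoarseAmen.CayleySpace (S : Set G) hS),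
       ∃ F : CoarseAmen.Filtration G,
         CoarseAmen.FibredCoarselyAmenable (CoarseAmen.BoxSpace (S : Set G) hS F),
       ∀ F : CoarseAmen.Filtration G,
         CoarseAmen.FibredCoarselyAmenable (CoarseAmen.BoxSpace (S : Set G) hS F)] := by
  tfae_have 1 → 3 := fun h F => h.fibred_boxSpace S.finite_toSet F
  tfae_have 3 → 2 := fun h => by
    obtain ⟨F⟩ := CoarseAmen.exists_filtration S.finite_toSet hS
    exact ⟨F, h F⟩
  tfae_have 2 → 1 := fun ⟨_, h⟩ => h.coarselyAmenable S.finite_toSet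
  tfae_finish
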